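/- All graphs are finite and simple. For graphs $H, J$, the strong product $H \boxtimes J$ has vertex set $V(H)\times V(J)$, and two vertices $(a,x)$, $(b,y)$ are adjacent if and only if one of the following holds: $ab\in E(H)$ and $xy\in E(J)$; or $a=b$ and $xy\in E(J)$; or $ab\in E(H)$ and $x=y$. A graph is called a $3$-polytope if it is planar (it can be drawn in the Euclidean plane so that edges meet only at vertices) and $3$-connected (it has more than three vertices, and removing fewer than three vertices, in any way, leaves a connected graph). Write $K_n$ for the complete graph and $P_n$ for the simple path on $n$ vertices. **Proposition.** Let $H$ and $J$ be graphs with at least two vertices each. Then $H\boxtimes J$ is a $3$-polytope if and only if $H\boxtimes J\cong K_4$ or $H\boxtimes J\cong P_3\boxtimes P_3$. Moreover $K_2\boxtimes K_2\cong K_4$. -/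

import Mathlib

namespace SimpleGraph

/-- The Kronecker (direct, tensor) product: `(a, x)` and `(b, y)` are adjacent if and only if
`ab` is an edge of `H` and `xy` is an edge of `J`. -/
def kroneckerProd {V W : Type*} (H : SimpleGraph V) (J : SimpleGraph W) :
    SimpleGraph (V × W) where
  Adj p q := H.Adj p.1 q.1 ∧ J.Adj p.2 q.2
  symm := ⟨fun _ _ h => ⟨h.1.symm, h.2.symm⟩⟩
  loopless := ⟨fun _ h => h.1.ne rfl⟩

/-- The strong product: its edge set is the union of the edge sets of the Kronecker product and
of the Cartesian (box) product. -/
def strongProd {V W : Type*} (H : SimpleGraph V) (J : SimpleGraph W) : SimpleGraph (V × W) :=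
  H.kroneckerProd J ⊔ (H □ J)

/-- `G` is `k`-connected: it has more than `k` vertices, and removing fewer than `k` vertices, in
any way, leaves a connected graph. -/
def IsVertexConnected {V : Type*} (G : SimpleGraph V) (k : ℕ) : Prop :=
  (k : ℕ∞) < ENat.card V ∧
    ∀ S : Finset V, S.card < k → (G.induce {v : V | v ∉ S}).Connected

/-- A drawing of `G` in the Euclidean plane without crossings: distinct vertices are distinct
points, every edge is a simple arc joining its ends (traversed backwards when the edge is read
backwards), an arc passes through no vertex besides its own ends, and two distinct edges meet in
vertices only. -/
structure PlaneDrawing {V : Type*} (G : SimpleGraph V) where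
  point : V → EuclideanSpace ℝ (Fin 2)
  point_injective : Function.Injective point
  arc : ∀ {u v : V}, G.Adj u v → _root_.Path (point u) (point v)
  arc_symm : ∀ {u v : V} (h : G.Adj u v), arc h.symm = (arc h).symm
  arc_injective : ∀ {u v : V} (h : G.Adj u v), Function.Injective (arc h)
  vertex_of_mem_arc : ∀ {u v : V} (h : G.Adj u v) (w : V),
    point w ∈ Set.range (arc h) → w = u ∨ w = v
  arc_inter_arc : ∀ {u v u' v' : V} (h : G.Adj u v) (h' : G.Adj u' v'),
    s(u, v) ≠ s(u', v') → Set.range (arc h) ∩ Set.range (arc h') ⊆ Set.range point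

/-- A graph is planar if it can be drawn in the plane without crossings. -/
def IsPlanar {V : Type*} (G : SimpleGraph V) : Prop :=
  Nonempty G.PlaneDrawing

/-- A graph is `3`-polytopal (a `3`-polytope, for short) if it is planar and `3`-connected. -/
def IsThreePolytope {V : Type*} (G : SimpleGraph V) : Prop :=
  G.IsPlanar ∧ G.IsVertexConnected 3

end SimpleGraph

/-! ### Continuous logarithms and the nonplanarity of `K₃₃` -/

namespace ContinuousLog

/-! Nonplanarity always comes from a `K₃₃` minor (`IsPlanar.false_of_branch_sets`), and planarity
from a single explicit drawing.

A 3-connected product has connected factors. Suppose one factor is an edge and the other, `J`, has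
at least three vertices. The fibre over the middle vertex of a path `a b c` in `J` has only two
vertices, so deleting it leaves `a` and `c` joined: `J` has a cycle through `b`. But an edge times a
cycle contracts to `K₆`, which contains `K₃₃`. If both factors have at least three vertices, each
contains a path on three vertices, so the other contains neither a triangle nor a claw nor a path on
four vertices; both are `P₃`. Two factors of order two give `K₄`. Conversely, `P₃ ⊠ P₃` has a
straight-line drawing, its connectivity is a finite check, and `K₄` is a subgraph of it.

`K₃₃` itself is excluded by winding numbers. For disjoint arcs the difference `δ t - γ s` never
vanishes, so its logarithm has zero total increment around the parameter square. Adding this over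
the 18 pairs of disjoint edges equates an even number with an odd one. -/

theorem exists_continuous_log {X : Type*} [TopologicalSpace X] [SimplyConnectedSpace X]
    [LocallyPathConnectedSpace X] {g : X → ℂ} (hg : Continuous g) (h0 : ∀ x, g x ≠ 0) :
    ∃ l : X → ℂ, Continuous l ∧ ∀ x, Complex.exp (l x) = g x := by
  obtain ⟨x₀⟩ : Nonempty X := inferInstance
  obtain ⟨F, ⟨-, hF⟩, -⟩ := Complex.isCoveringMapOn_exp.existsUnique_continuousMap_lifts
    ⟨g, hg⟩ (Complex.exp_log (h0 x₀)) (fun x => h0 x)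
  exact ⟨F, F.continuous, fun x => congrFun hF x⟩

/-- Both branches lift the same map through the covering `exp`, so they differ by a constant. -/
theorem log_sub_eq {g l l' : ℝ → ℂ} (hl : Continuous l) (hl' : Continuous l')
    (h : ∀ x, Complex.exp (l x) = g x) (h' : ∀ x, Complex.exp (l' x) = g x) :
    l 1 - l 0 = l' 1 - l' 0 := by
  have key : l = fun x => l' x + (l 0 - l' 0) := by
    have hc := Complex.isCoveringMap_exp
    refine hc.eq_of_comp_eq hl (by fun_prop) ?_ 0 (by simp)
    funext x
    have e0 : Complex.exp (l 0 - l' 0) = 1 := by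
      rw [Complex.exp_sub, h, h', div_self]
      rw [← h]; exact Complex.exp_ne_zero _
    simp [Complex.exp_add, e0, h, h']
  have := congrFun key 1
  linear_combination this

/-- The increment over `[0, 1]` of a continuous branch of `log ∘ g`. -/
noncomputable def logIncrement (g : ℝ → ℂ) : ℂ :=
  open Classical in
  if h : ∃ l : ℝ → ℂ, Continuous l ∧ ∀ x, Complex.exp (l x) = g x then
    h.choose 1 - h.choose 0 else 0

theorem logIncrement_eq {g l : ℝ → ℂ} (hl : Continuous l) (h : ∀ x, Complex.exp (l x) = g x) :
    logIncrement g = l 1 - l 0 := by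
  have hex : ∃ l : ℝ → ℂ, Continuous l ∧ ∀ x, Complex.exp (l x) = g x := ⟨l, hl, h⟩
  rw [logIncrement, dif_pos hex]
  exact log_sub_eq hex.choose_spec.1 hl hex.choose_spec.2 h

/-- With logarithms of the end values fixed, the only unknown in an increment is an integer; these
integers carry the parity count. -/
theorem logIncrement_spec {g : ℝ → ℂ} (hg : Continuous g) (h0 : ∀ x, g x ≠ 0) {u v : ℂ}
    (hu : Complex.exp u = g 0) (hv : Complex.exp v = g 1) :
    ∃ n : ℤ, logIncrement g = v - u + n * (2 * Real.pi * Complex.I) := by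
  obtain ⟨l, hl, h⟩ := exists_continuous_log hg h0
  have e : Complex.exp (l 1 - l 0) = Complex.exp (v - u) := by
    rw [Complex.exp_sub, Complex.exp_sub, h, h, hu, hv]
  obtain ⟨n, hn⟩ := Complex.exp_eq_exp_iff_exists_int.1 e
  exact ⟨n, by rw [logIncrement_eq hl h, hn]⟩

/-- The four sides of the square of differences of two disjoint curves. -/
theorem logIncrement_square {γ δ : ℝ → ℂ} (hγ : Continuous γ) (hδ : Continuous δ)
    (h0 : ∀ s t, γ s ≠ δ t) :
    logIncrement (fun t => δ t - γ 0) + logIncrement (fun s => γ s - δ 1) =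
      logIncrement (fun t => δ t - γ 1) + logIncrement (fun s => γ s - δ 0) := by
  -- One branch on the whole parameter plane measures all four sides at once.
  obtain ⟨l, hl, h⟩ := exists_continuous_log (X := ℝ × ℝ) (g := fun p => δ p.2 - γ p.1)
    (by fun_prop) (fun p => sub_ne_zero.2 (h0 _ _).symm)
  have hd : ∀ s, logIncrement (fun t => δ t - γ s) = l (s, 1) - l (s, 0) := fun s =>
    logIncrement_eq (l := fun t => l (s, t)) (by fun_prop) (fun t => h (s, t))
  have hg : ∀ t, logIncrement (fun s => γ s - δ t) = l (1, t) - l (0, t) := fun t => by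
    rw [logIncrement_eq (l := fun s => l (s, t) + Real.pi * Complex.I) (by fun_prop)]
    · ring
    · intro s
      rw [Complex.exp_add, h, Complex.exp_pi_mul_I]
      ring
  rw [hd, hd, hg, hg]
  ring

/-- A choice of logarithms of all differences `p j - p i` such that opposite differences get
logarithms that differ by `π * I`. -/
noncomputable def diffLog {ι : Type*} [LinearOrder ι] (p : ι → ℂ) (i j : ι) : ℂ :=
  if i < j then Complex.log (p j - p i) else Complex.log (p i - p j) + Real.pi * Complex.I

theorem exp_diffLog {ι : Type*} [LinearOrder ι] {p : ι → ℂ} {i j : ι} (h : p i ≠ p j) :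
    Complex.exp (diffLog p i j) = p j - p i := by
  unfold diffLog
  split_ifs
  · exact Complex.exp_log (sub_ne_zero.2 h.symm)
  · rw [Complex.exp_add, Complex.exp_log (sub_ne_zero.2 h), Complex.exp_pi_mul_I]
    ring

theorem diffLog_symm {ι : Type*} [LinearOrder ι] (p : ι → ℂ) {i j : ι} (h : i < j) :
    diffLog p j i = diffLog p i j + Real.pi * Complex.I := by
  simp [diffLog, h, h.not_gt]

/-- `K₃₃` cannot be drawn in the plane so that vertex-disjoint edges do not meet. -/
theorem not_bipartite_three_three_drawing (a b : Fin 3 → ℂ) (γ : Fin 3 → Fin 3 → ℝ → ℂ)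
    (hγ : ∀ i j, Continuous (γ i j)) (h0 : ∀ i j, γ i j 0 = a i) (h1 : ∀ i j, γ i j 1 = b j)
    (hd : ∀ i j i' j', i ≠ i' → j ≠ j' → ∀ s t, γ i j s ≠ γ i' j' t) : False := by
  have other : ∀ i : Fin 3, ∃ k, i ≠ k := by decide
  have ha : ∀ i i' j t, i ≠ i' → a i ≠ γ i' j t := fun i i' j t hi => by
    obtain ⟨k, hk⟩ := other j
    rw [← h0 i k]
    exact hd _ _ _ _ hi hk.symm _ _
  have hb : ∀ j j' i t, j ≠ j' → b j ≠ γ i j' t := fun j j' i t hj => by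
    obtain ⟨k, hk⟩ := other i
    rw [← h1 k j]
    exact hd _ _ _ _ hk.symm hj _ _
  have haa : ∀ i i', i ≠ i' → a i ≠ a i' := fun i i' hi => by
    rw [← h0 i' 0]; exact ha _ _ _ _ hi
  have hbb : ∀ i i', i ≠ i' → b i ≠ b i' := fun i i' hi => by
    rw [← h1 0 i']; exact hb _ _ _ _ hi
  have hab : ∀ i j, a i ≠ b j := fun i j => by
    obtain ⟨k, hk⟩ := other i
    rw [← h1 k j]
    exact ha _ _ _ _ hk
  have hn : ∀ i i' j, ∃ n : ℤ, i ≠ i' → logIncrement (fun t => γ i' j t - a i) =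
      Complex.log (b j - a i) - diffLog a i i' + n * (2 * Real.pi * Complex.I) := by
    intro i i' j
    by_cases hi : i = i'
    · exact ⟨0, fun h => (h hi).elim⟩
    obtain ⟨n, hn⟩ := logIncrement_spec (g := fun t => γ i' j t - a i)
      (u := diffLog a i i') (v := Complex.log (b j - a i)) ((hγ i' j).sub continuous_const)
      (fun t => sub_ne_zero.2 (ha _ _ _ _ hi).symm)
      (by rw [exp_diffLog (haa _ _ hi), h0])
      (by rw [Complex.exp_log (sub_ne_zero.2 (hab _ _).symm), h1])
    exact ⟨n, fun _ => hn⟩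
  have hm : ∀ j j' i, ∃ m : ℤ, j ≠ j' → logIncrement (fun t => γ i j' t - b j) =
      diffLog b j j' - Complex.log (b j - a i) - Real.pi * Complex.I + m * (2 * Real.pi * Complex.I) := by
    intro j j' i
    by_cases hj : j = j'
    · exact ⟨0, fun h => (h hj).elim⟩
    obtain ⟨m, hm⟩ := logIncrement_spec (g := fun t => γ i j' t - b j)
      (u := Complex.log (b j - a i) + Real.pi * Complex.I)
      (v := diffLog b j j') ((hγ i j').sub continuous_const)
      (fun t => sub_ne_zero.2 (hb _ _ _ _ hj).symm)
      (by rw [Complex.exp_add, Complex.exp_log (sub_ne_zero.2 (hab _ _).symm), h0,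
            Complex.exp_pi_mul_I]; ring)
      (by rw [exp_diffLog (hbb _ _ hj), h1])
    exact ⟨m, fun _ => by rw [hm]; ring⟩
  choose n hn using hn
  choose m hm using hm
  -- The chosen logarithms cancel except for the half turns of `diffLog`: those of `a` and `b` add
  -- up to a full turn if `j < j'` and cancel otherwise.
  have rel : ∀ i i' j j', i < i' → j ≠ j' →
      n i i' j' + m j' j i - n i' i j - m j j' i' = if j < j' then -1 else 0 := by
    intro i i' j j' hi hj
    have e := logIncrement_square (hγ i j) (hγ i' j') (hd i j i' j' hi.ne hj)
    rw [h0, h0, h1, h1, hn _ _ _ hi.ne, hn _ _ _ hi.ne', hm _ _ _ hj, hm _ _ _ hj.symm,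
      diffLog_symm a hi] at e
    have hp : (2 * Real.pi * Complex.I : ℂ) ≠ 0 := Complex.two_pi_I_ne_zero
    rw [← Int.cast_inj (α := ℂ)]
    refine mul_right_cancel₀ hp ?_
    rcases lt_or_gt_of_ne hj with h | h
    · rw [diffLog_symm b h] at e
      simp only [h, if_true]
      push_cast
      linear_combination e
    · rw [diffLog_symm b h] at e
      simp only [h.not_gt, if_false]
      push_cast
      linear_combination e
  have sum_rel := fun i i' (h : i < i') =>
    And.intro (And.intro (rel i i' 0 1 h (by decide)) (rel i i' 0 2 h (by decide)))
      (And.intro (And.intro (rel i i' 1 2 h (by decide)) (rel i i' 1 0 h (by decide)))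
      (And.intro (rel i i' 2 0 h (by decide)) (rel i i' 2 1 h (by decide))))
  have r₁ := sum_rel 0 1 (by decide)
  have r₂ := sum_rel 0 2 (by decide)
  have r₃ := sum_rel 1 2 (by decide)
  simp only [Fin.reduceLT, if_true, if_false] at r₁ r₂ r₃
  -- Each integer `n` or `m` occurs in exactly two of the 18 relations, with coefficient `±1`, so
  -- the left sides have an even sum; the right sides sum to `-9`.
  omega

end ContinuousLog

/-! ### Drawings, walks and `K₃₃` minors -/

namespace SimpleGraph

namespace PlaneDrawing

variable {V : Type*} {G : SimpleGraph V}

/-- The curve that a drawing assigns to a walk. -/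
noncomputable def walkPath (D : G.PlaneDrawing) :
    ∀ {u v : V}, G.Walk u v → _root_.Path (D.point u) (D.point v)
  | _, _, .nil => .refl _
  | _, _, .cons h p => (D.arc h).trans (D.walkPath p)

theorem exists_of_mem_range_walkPath (D : G.PlaneDrawing) {u v : V} (w : G.Walk u v)
    {z : EuclideanSpace ℝ (Fin 2)} (hz : z ∈ Set.range (D.walkPath w)) :
    (∃ x ∈ w.support, D.point x = z) ∨
      ∃ (x y : V) (h : G.Adj x y), x ∈ w.support ∧ y ∈ w.support ∧ z ∈ Set.range (D.arc h) := by
  induction w with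
  | nil =>
    obtain ⟨t, rfl⟩ := hz
    exact .inl ⟨_, Walk.start_mem_support _, rfl⟩
  | cons h p ih =>
    rw [walkPath, Path.trans_range] at hz
    rcases hz with hz | hz
    · exact .inr ⟨_, _, h, by simp, by simp, hz⟩
    · rcases ih hz with ⟨x, hx, e⟩ | ⟨x, y, h', hx, hy, e⟩
      · exact .inl ⟨x, by simp [hx], e⟩
      · exact .inr ⟨x, y, h', by simp [hx], by simp [hy], e⟩

theorem disjoint_range_walkPath (D : G.PlaneDrawing) {u v u' v' : V} (w : G.Walk u v)
    (w' : G.Walk u' v') (hd : w.support.Disjoint w'.support) :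
    Disjoint (Set.range (D.walkPath w)) (Set.range (D.walkPath w')) := by
  refine Set.disjoint_left.2 fun z hz hz' => ?_
  rcases D.exists_of_mem_range_walkPath w hz with ⟨x, hx, e⟩ | ⟨x, y, h, hx, hy, e⟩ <;>
  rcases D.exists_of_mem_range_walkPath w' hz' with ⟨x', hx', e'⟩ | ⟨x', y', h', hx', hy', e'⟩
  · exact hd hx (D.point_injective (e.trans e'.symm) ▸ hx')
  · subst e
    rcases D.vertex_of_mem_arc h' x e' with rfl | rfl
    exacts [hd hx hx', hd hx hy']
  · subst e'
    rcases D.vertex_of_mem_arc h x' e with rfl | rfl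
    exacts [hd hx hx', hd hy hx']
  · obtain ⟨t, rfl⟩ := D.arc_inter_arc h h' (fun hs => by
      rcases Sym2.eq_iff.1 hs with ⟨rfl, rfl⟩ | ⟨rfl, rfl⟩
      exacts [hd hx hx', hd hx hy']) ⟨e, e'⟩
    rcases D.vertex_of_mem_arc h t e with rfl | rfl <;>
    rcases D.vertex_of_mem_arc h' t e' with rfl | rfl
    exacts [hd hx hx', hd hx hy', hd hy hx', hd hy hy']

end PlaneDrawing

/-- A planar graph has no nine walks that join two triples of vertices like the edges of `K₃₃`,
the walks for vertex-disjoint edges being vertex-disjoint. -/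
theorem IsPlanar.false_of_walks {V : Type*} {G : SimpleGraph V} (hG : G.IsPlanar)
    {a b : Fin 3 → V} (w : ∀ i j, G.Walk (a i) (b j))
    (hw : ∀ i j i' j', i < i' → j ≠ j' → (w i j).support.Disjoint (w i' j').support) :
    False := by
  obtain ⟨D⟩ := hG
  let φ := Complex.orthonormalBasisOneI.repr.symm
  refine ContinuousLog.not_bipartite_three_three_drawing (fun i => φ (D.point (a i)))
    (fun j => φ (D.point (b j))) (fun i j t => φ ((D.walkPath (w i j)).extend t))
    (fun i j => by fun_prop) (by simp) (by simp) ?_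
  intro i j i' j' hi hj s t e
  have hdis : Disjoint (Set.range (D.walkPath (w i j))) (Set.range (D.walkPath (w i' j'))) := by
    rcases lt_or_gt_of_ne hi with h | h
    · exact D.disjoint_range_walkPath _ _ (hw _ _ _ _ h hj)
    · exact (D.disjoint_range_walkPath _ _ (hw _ _ _ _ h hj.symm)).symm
  rw [← Path.extend_range (D.walkPath (w i j)), ← Path.extend_range (D.walkPath (w i' j'))] at hdis
  exact Set.disjoint_left.1 hdis ⟨s, rfl⟩ ⟨t, (φ.injective e).symm⟩

/-- Two vertices are joined by a walk all of whose vertices lie in `S`. -/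
def WalkIn {V : Type*} (G : SimpleGraph V) (S : Set V) (u v : V) : Prop :=
  ∃ w : G.Walk u v, ∀ x ∈ w.support, x ∈ S

namespace WalkIn

variable {V : Type*} {G : SimpleGraph V} {S : Set V} {u v t : V}

theorem refl (hu : u ∈ S) : G.WalkIn S u u := ⟨.nil, by simpa using hu⟩

theorem of_adj (h : G.Adj u v) (hu : u ∈ S) (hv : v ∈ S) : G.WalkIn S u v :=
  ⟨h.toWalk, by simp [hu, hv]⟩

theorem symm (h : G.WalkIn S u v) : G.WalkIn S v u := by
  obtain ⟨w, hw⟩ := h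
  exact ⟨w.reverse, by simpa using hw⟩

theorem trans (h : G.WalkIn S u v) (h' : G.WalkIn S v t) : G.WalkIn S u t := by
  obtain ⟨w, hw⟩ := h
  obtain ⟨w', hw'⟩ := h'
  refine ⟨w.append w', fun x hx => ?_⟩
  rcases Walk.mem_support_append_iff _ _ |>.1 hx with hx | hx
  exacts [hw x hx, hw' x hx]

end WalkIn

/-- A planar graph has no `K₃₃` minor. -/
theorem IsPlanar.false_of_branch_sets {V : Type*} {G : SimpleGraph V} (hG : G.IsPlanar)
    (a b : Fin 3 → V) (A B : Fin 3 → Set V) (hA : ∀ i i', i < i' → Disjoint (A i) (A i'))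
    (hB : ∀ j j', j < j' → Disjoint (B j) (B j')) (hAB : ∀ i j, Disjoint (A i) (B j))
    (h : ∀ i j, G.WalkIn (A i ∪ B j) (a i) (b j)) : False := by
  choose w hw using h
  refine hG.false_of_walks w fun i j i' j' hi hj x hx hx' => ?_
  rcases hw _ _ x hx with h | h <;> rcases hw _ _ x hx' with h' | h'
  · exact Set.disjoint_left.1 (hA _ _ hi) h h'
  · exact Set.disjoint_left.1 (hAB _ _) h h'
  · exact Set.disjoint_left.1 (hAB _ _) h' h
  · rcases lt_or_gt_of_ne hj with h'' | h''
    · exact Set.disjoint_left.1 (hB _ _ h'') h h'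
    · exact Set.disjoint_left.1 (hB _ _ h'') h' h

/-! ### Nonplanar strong products -/

section StrongProduct

variable {V W : Type*} {H : SimpleGraph V} {J : SimpleGraph W}

theorem strongProd_adj {p q : V × W} : (H.strongProd J).Adj p q ↔
    (H.Adj p.1 q.1 ∧ J.Adj p.2 q.2) ∨ (H.Adj p.1 q.1 ∧ p.2 = q.2) ∨
      (J.Adj p.2 q.2 ∧ p.1 = q.1) := by
  simp [strongProd, kroneckerProd, boxProd_adj]

theorem strongProd_adj_of_adj_of_adj {x x' : V} {y y' : W} (h : H.Adj x x') (h' : J.Adj y y') :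
    (H.strongProd J).Adj (x, y) (x', y') := strongProd_adj.2 (.inl ⟨h, h'⟩)

theorem strongProd_adj_left {x x' : V} (h : H.Adj x x') (y : W) :
    (H.strongProd J).Adj (x, y) (x', y) := strongProd_adj.2 (.inr (.inl ⟨h, rfl⟩))

theorem strongProd_adj_right (x : V) {y y' : W} (h : J.Adj y y') :
    (H.strongProd J).Adj (x, y) (x, y') := strongProd_adj.2 (.inr (.inr ⟨h, rfl⟩))

/-- The strong product of a path on three vertices and a claw is not planar. -/
theorem not_isPlanar_strongProd_of_claw {x y z : V} (hxy : H.Adj x y) (hyz : H.Adj y z)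
    (hxz : x ≠ z) {b : W} {l : Fin 3 → W} (hl : Function.Injective l) (hb : ∀ j, J.Adj b (l j)) :
    ¬ (H.strongProd J).IsPlanar := by
  intro hG
  have hx : Function.Injective ![x, y, z] := by
    intro i j h
    have := hxy.ne; have := hyz.ne
    fin_cases i <;> fin_cases j <;> simp_all
  refine hG.false_of_branch_sets (fun i => (![x, y, z] i, b)) (fun j => (y, l j))
    (fun i => {(![x, y, z] i, b)}) (fun j => {(y, l j)}) (fun i i' h => ?_) (fun j j' h => ?_)
    (fun i j => ?_) (fun i j => ?_)
  · simpa using hx.ne h.ne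
  · simpa using hl.ne h.ne
  · simpa using fun _ => (hb j).ne
  · refine .of_adj ?_ (by simp) (by simp)
    fin_cases i
    · exact strongProd_adj_of_adj_of_adj hxy (hb j)
    · exact strongProd_adj_right _ (hb j)
    · exact strongProd_adj_of_adj_of_adj hyz.symm (hb j)

/-- The strong product of a path on three vertices and a path on four vertices is not planar. -/
theorem not_isPlanar_strongProd_of_path {x y z : V} (hxy : H.Adj x y) (hyz : H.Adj y z)
    (hxz : x ≠ z) {p q r s : W} (hpq : J.Adj p q) (hqr : J.Adj q r) (hrs : J.Adj r s)
    (hpr : p ≠ r) (hps : p ≠ s) (hqs : q ≠ s) : ¬ (H.strongProd J).IsPlanar := by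
  intro hG
  have n₁ := hxy.ne; have n₂ := hyz.ne; have n₃ := hpq.ne; have n₄ := hqr.ne; have n₅ := hrs.ne
  -- Only two of the nine edges of `K₃₃` are missing: `(y, p)` links `(z, q)` to `(x, q)`, and `(y,
  -- s)` links `(x, r)` to `(z, r)`.
  refine hG.false_of_branch_sets ![(z, q), (x, r), (y, q)] ![(z, r), (x, q), (y, r)]
    ![{(z, q), (y, p)}, {(x, r), (y, s)}, {(y, q)}] ![{(z, r)}, {(x, q)}, {(y, r)}]
    (fun i i' h => ?_) (fun i i' h => ?_) (fun i i' => ?_) (fun i i' => ?_)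
  · fin_cases i <;> fin_cases i' <;> simp at h ⊢ <;> grind
  · fin_cases i <;> fin_cases i' <;> simp at h ⊢ <;> grind
  · fin_cases i <;> fin_cases i' <;> simp <;> grind
  · have step : ∀ {S : Set (V × W)} {u v : V × W}, (H.strongProd J).Adj u v → u ∈ S → v ∈ S →
        (H.strongProd J).WalkIn S u v := fun h hu hv => .of_adj h hu hv
    fin_cases i <;> fin_cases i'
    · exact step (strongProd_adj_right _ hqr) (by simp) (by simp)
    · exact .trans (v := (y, p)) (step (strongProd_adj_of_adj_of_adj hyz.symm hpq.symm)
        (by simp) (by simp)) (step (strongProd_adj_of_adj_of_adj hxy.symm hpq) (by simp) (by simp))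
    · exact step (strongProd_adj_of_adj_of_adj hyz.symm hqr) (by simp) (by simp)
    · exact .trans (v := (y, s)) (step (strongProd_adj_of_adj_of_adj hxy hrs)
        (by simp) (by simp)) (step (strongProd_adj_of_adj_of_adj hyz hrs.symm) (by simp) (by simp))
    · exact step (strongProd_adj_right _ hqr.symm) (by simp) (by simp)
    · exact step (strongProd_adj_left hxy _) (by simp) (by simp)
    · exact step (strongProd_adj_of_adj_of_adj hyz hqr) (by simp) (by simp)
    · exact step (strongProd_adj_left hxy.symm _) (by simp) (by simp)
    · exact step (strongProd_adj_right _ hqr) (by simp) (by simp)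

theorem WalkIn.strongProd_right {T : Set W} {y y' : W} (h : J.WalkIn T y y') (x : V) :
    (H.strongProd J).WalkIn {u | u.1 = x ∧ u.2 ∈ T} (x, y) (x, y') := by
  obtain ⟨w, hw⟩ := h
  refine ⟨w.map (⟨fun y => (x, y), fun h => strongProd_adj_right x h⟩ : J →g H.strongProd J), ?_⟩
  simpa using hw

/-- The strong product of an edge and a graph with a cycle is not planar. -/
theorem not_isPlanar_strongProd_of_cycle {x y : V} (hxy : H.Adj x y) {a b c d : W}
    (hab : J.Adj a b) (hbc : J.Adj b c) (had : J.Adj a d) {T : Set W} (ha : a ∉ T) (hb : b ∉ T)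
    (h : J.WalkIn T d c) : ¬ (H.strongProd J).IsPlanar := by
  intro hG
  have mono : ∀ {S S' : Set (V × W)} {u v}, (H.strongProd J).WalkIn S u v → S ⊆ S' →
      (H.strongProd J).WalkIn S' u v := fun h hS => h.imp fun _ hw x hx => hS (hw x hx)
  have hcT : c ∈ T := h.choose_spec _ (Walk.end_mem_support _)
  have hdT : d ∈ T := h.choose_spec _ (Walk.start_mem_support _)
  have n₁ := hxy.ne; have n₂ := hab.ne
  -- Contracting the part of the cycle in `T` leaves a triangle; its copies over `x` and `y` are the
  -- two sides of `K₃₃`.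
  refine hG.false_of_branch_sets ![(x, a), (x, b), (x, c)] ![(y, a), (y, b), (y, c)]
    ![{(x, a)}, {(x, b)}, {u | u.1 = x ∧ u.2 ∈ T}] ![{(y, a)}, {(y, b)}, {u | u.1 = y ∧ u.2 ∈ T}]
    (fun i i' h => ?_) (fun i i' h => ?_) (fun i i' => ?_) (fun i i' => ?_)
  · fin_cases i <;> fin_cases i' <;> simp_all
  · fin_cases i <;> fin_cases i' <;> simp_all
  · rw [Set.disjoint_left]
    rintro ⟨u, v⟩ h₁ h₂
    fin_cases i <;> fin_cases i' <;> simp at h₁ h₂ <;> grind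
  · fin_cases i <;> fin_cases i'
    · exact .of_adj (strongProd_adj_left hxy _) (by simp) (by simp)
    · exact .of_adj (strongProd_adj_of_adj_of_adj hxy hab) (by simp) (by simp)
    · exact .trans (v := (y, d)) (.of_adj (strongProd_adj_of_adj_of_adj hxy had) (by simp)
        (by simp [hdT])) (mono (h.strongProd_right y) (by simp))
    · exact .of_adj (strongProd_adj_of_adj_of_adj hxy hab.symm) (by simp) (by simp)
    · exact .of_adj (strongProd_adj_left hxy _) (by simp) (by simp)
    · exact .of_adj (strongProd_adj_of_adj_of_adj hxy hbc) (by simp) (by simp [hcT])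
    · exact .trans (v := (x, d)) (mono (h.symm.strongProd_right x) (by simp))
        (.of_adj (strongProd_adj_of_adj_of_adj hxy had.symm) (by simp [hdT]) (by simp))
    · exact .of_adj (strongProd_adj_of_adj_of_adj hxy hbc.symm) (by simp [hcT]) (by simp)
    · exact .of_adj (strongProd_adj_left hxy _) (by simp [hcT]) (by simp [hcT])

end StrongProduct

/-! ### Transfer of planarity and connectivity -/

theorem IsPlanar.of_hom {V V' : Type*} {G : SimpleGraph V} {G' : SimpleGraph V'}
    (h : G'.IsPlanar) (f : G →g G') (hf : Function.Injective f) : G.IsPlanar := by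
  obtain ⟨D⟩ := h
  refine ⟨{ point := D.point ∘ f
            point_injective := D.point_injective.comp hf
            arc := fun h => D.arc (f.map_adj h)
            arc_symm := fun h => D.arc_symm (f.map_adj h)
            arc_injective := fun h => D.arc_injective (f.map_adj h)
            vertex_of_mem_arc := fun h w hw => by
              simpa [hf.eq_iff] using D.vertex_of_mem_arc (f.map_adj h) (f w) hw
            arc_inter_arc := fun {u v u' v'} h h' hne z hz => ?_ }⟩
  -- The meeting point is a vertex of `G'` on an arc, hence an end of that arc and so in the image
  -- of `f`.
  obtain ⟨t, rfl⟩ := D.arc_inter_arc (f.map_adj h) (f.map_adj h')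
    (fun e => hne (Sym2.map.injective hf (by simpa using e))) hz
  rcases D.vertex_of_mem_arc (f.map_adj h) t hz.1 with rfl | rfl
  exacts [⟨u, rfl⟩, ⟨v, rfl⟩]

theorem isVertexConnected_iff_walkIn {V : Type*} {G : SimpleGraph V} {k : ℕ} :
    G.IsVertexConnected k ↔ (k : ℕ∞) < ENat.card V ∧ ∀ S : Finset V, S.card < k →
      ∀ u ∉ S, ∀ v ∉ S, G.WalkIn {x | x ∉ S} u v := by
  refine and_congr_right fun hk => forall₂_congr fun S hS => ⟨fun h u hu v hv => ?_, fun h => ?_⟩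
  · obtain ⟨w⟩ := h.preconnected ⟨u, hu⟩ ⟨v, hv⟩
    refine ⟨w.map (Embedding.induce {v : V | v ∉ S}).toHom, fun x hx => ?_⟩
    obtain ⟨y, -, rfl⟩ := List.mem_map.1 ((Walk.support_map _ _).symm ▸ hx)
    exact y.2
  · refine (connected_iff _).2 ⟨fun u v => ?_, ?_⟩
    · obtain ⟨w, hw⟩ := h u u.2 v v.2
      exact ⟨w.induce _ hw⟩
    · by_contra hne
      have : ∀ x, x ∈ S := fun x => by_contra fun hx => hne ⟨x, hx⟩
      have hV : ENat.card V ≤ S.card := by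
        rw [← Set.encard_univ, ← Set.encard_coe_eq_coe_finsetCard]
        exact Set.encard_le_encard fun x _ => this x
      exact (hk.trans_le hV).not_ge (by exact_mod_cast hS.le)

theorem IsVertexConnected.of_iso {V V' : Type*} {G : SimpleGraph V} {G' : SimpleGraph V'} {k : ℕ}
    (h : G'.IsVertexConnected k) (e : G ≃g G') : G.IsVertexConnected k := by
  rw [isVertexConnected_iff_walkIn] at h ⊢
  refine ⟨by rw [ENat.card_congr e.toEquiv]; exact h.1, fun S hS u hu v hv => ?_⟩
  have hm : ∀ x, e x ∈ S.map e.toEquiv.toEmbedding ↔ x ∈ S := fun x => Finset.mem_map' _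
  obtain ⟨w, hw⟩ := h.2 (S.map e.toEquiv.toEmbedding) (by simpa using hS) (e u)
    ((hm u).not.2 hu) (e v) ((hm v).not.2 hv)
  refine ⟨(w.map e.symm.toHom).copy (by simp) (by simp), fun x hx => ?_⟩
  refine (hm x).not.1 (hw _ ?_)
  simp only [Walk.support_copy, Walk.support_map, List.mem_map] at hx
  obtain ⟨y, hy, rfl⟩ := hx
  simpa using hy

theorem IsThreePolytope.of_iso {V V' : Type*} {G : SimpleGraph V} {G' : SimpleGraph V'}
    (h : G'.IsThreePolytope) (e : G ≃g G') : G.IsThreePolytope :=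
  ⟨h.1.of_hom e.toHom e.injective, h.2.of_iso e⟩

/-! ### Strong products that can be 3-polytopes -/

section StrongProduct

variable {V W : Type*} {H : SimpleGraph V} {J : SimpleGraph W}

/-- The strong product is commutative up to isomorphism. -/
def strongProdComm (H : SimpleGraph V) (J : SimpleGraph W) : H.strongProd J ≃g J.strongProd H where
  toEquiv := Equiv.prodComm V W
  map_rel_iff' := by
    intro p q
    simp only [strongProd_adj, Equiv.prodComm_apply, Prod.fst_swap, Prod.snd_swap]
    tauto

/-- Isomorphic factors have isomorphic strong products. -/
def strongProdCongr {V' W' : Type*} {H' : SimpleGraph V'} {J' : SimpleGraph W'} (e : H ≃g H')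
    (f : J ≃g J') : H.strongProd J ≃g H'.strongProd J' where
  toEquiv := Equiv.prodCongr e.toEquiv f.toEquiv
  map_rel_iff' := by
    intro p q
    simp [strongProd_adj, Iso.map_adj_iff]

/-- Each step of the product projects to an edge of `J` or to a single vertex. -/
theorem WalkIn.snd_of_strongProd {T : Set W} {p q : V × W}
    (h : (H.strongProd J).WalkIn {u | u.2 ∈ T} p q) : J.WalkIn T p.2 q.2 := by
  obtain ⟨w, hw⟩ := h
  induction w with
  | nil => exact ⟨.nil, by simpa using hw⟩
  | @cons u v _ h w ih =>
    have ih := ih fun x hx => hw x (by simp [hx])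
    have hu : u.2 ∈ T := hw u (by simp)
    have hv : v.2 ∈ T := hw v (by simp)
    rcases strongProd_adj.1 h with h | h | h
    · exact .trans (.of_adj h.2 hu hv) ih
    · rwa [h.2]
    · exact .trans (.of_adj h.1 hu hv) ih

theorem preconnected_right_of_strongProd [Nonempty V]
    (h : (H.strongProd J).IsVertexConnected 3) : J.Preconnected := by
  obtain ⟨x⟩ := ‹Nonempty V›
  intro y y'
  obtain ⟨w, hw⟩ := (isVertexConnected_iff_walkIn.1 h).2 ∅ (by simp) (x, y) (by simp)
    (x, y') (by simp)
  obtain ⟨w', -⟩ := WalkIn.snd_of_strongProd (T := Set.univ) ⟨w, by simp⟩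
  exact ⟨w'⟩

theorem preconnected_left_of_strongProd [Nonempty W]
    (h : (H.strongProd J).IsVertexConnected 3) : H.Preconnected :=
  preconnected_right_of_strongProd (h.of_iso (strongProdComm J H))

theorem Preconnected.exists_adj_notMem {V : Type*} {G : SimpleGraph V} (hG : G.Preconnected)
    {S : Set V} {u v : V} (hu : u ∈ S) (hv : v ∉ S) : ∃ x ∈ S, ∃ y ∉ S, G.Adj x y := by
  obtain ⟨w⟩ := hG u v
  obtain ⟨d, -, h₁, h₂⟩ := w.exists_boundary_dart S hu hv
  exact ⟨d.fst, h₁, d.snd, h₂, d.adj⟩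

theorem Preconnected.exists_adj_of_ne {V : Type*} {G : SimpleGraph V} (hG : G.Preconnected)
    {u v : V} (h : u ≠ v) : ∃ y, G.Adj u y := by
  obtain ⟨x, hx, y, -, hxy⟩ := hG.exists_adj_notMem (S := {u}) (v := v) rfl h.symm
  exact ⟨y, Set.mem_singleton_iff.1 hx ▸ hxy⟩

theorem Preconnected.exists_path_three {V : Type*} [Finite V] {G : SimpleGraph V}
    (hG : G.Preconnected) (hV : 3 ≤ Nat.card V) :
    ∃ a b c, a ≠ c ∧ G.Adj a b ∧ G.Adj b c := by
  have hout : ∀ S : Finset V, S.card < 3 → ∃ x, x ∉ S := fun S hS => by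
    by_contra! h
    have := Nat.card_congr (Equiv.subtypeUnivEquiv h)
    simp at this
    omega
  classical
  obtain ⟨p, -⟩ := hout ∅ (by simp)
  obtain ⟨q, hq⟩ := hout {p} (by simp)
  obtain ⟨y, hxy⟩ := hG.exists_adj_of_ne (u := p) (v := q) (by simpa [eq_comm] using hq)
  obtain ⟨r, hr⟩ := hout {p, y} ((Finset.card_le_two).trans_lt (by simp))
  obtain ⟨u, hu, z, hz, huz⟩ := hG.exists_adj_notMem (S := {p, y}) (u := p) (by simp)
    (by simpa using hr)
  simp only [Set.mem_insert_iff, Set.mem_singleton_iff, not_or] at hz hu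
  rcases hu with rfl | rfl
  · exact ⟨y, u, z, Ne.symm hz.2, hxy.symm, huz⟩
  · exact ⟨p, u, z, Ne.symm hz.1, hxy, huz⟩

theorem not_isThreePolytope_strongProd_of_card_eq_two [Finite V] [Finite W]
    (hV : Nat.card V = 2) (hW : 3 ≤ Nat.card W) : ¬ (H.strongProd J).IsThreePolytope := by
  rintro ⟨hp, hc⟩
  have : Nonempty V := (Nat.card_pos_iff.1 (by omega)).1
  have : Nonempty W := (Nat.card_pos_iff.1 (by omega)).1
  have hJ := preconnected_right_of_strongProd hc
  have hH := preconnected_left_of_strongProd hc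
  obtain ⟨x, x', hx, hxx⟩ := Nat.card_eq_two_iff.1 hV
  obtain ⟨y, hxy⟩ := hH.exists_adj_of_ne hx
  obtain ⟨a, b, c, hac, hab, hbc⟩ := hJ.exists_path_three hW
  classical
  obtain ⟨w, hw⟩ := (isVertexConnected_iff_walkIn.1 hc).2 {(x, b), (x', b)}
    (Finset.card_le_two.trans_lt (by simp)) (x, a) (by simp [hab.ne]) (x, c) (by simp [hbc.ne'])
  obtain ⟨w, hw⟩ := WalkIn.snd_of_strongProd (T := {b}ᶜ) (H := H) (J := J) ⟨w, fun u hu => by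
    have h₁ := hw u hu
    have h₂ : u.1 ∈ ({x, x'} : Set V) := hxx ▸ Set.mem_univ _
    simp only [Set.mem_insert_iff, Set.mem_singleton_iff] at h₂
    rintro rfl
    rcases h₂ with h | h <;> simp [Prod.ext_iff, h] at h₁⟩
  -- Passing to a path ensures that its tail after `a` avoids `a`, as it already avoids `b`; this
  -- tail is the rest of the cycle through `a` and `b`.
  have hw' : ∀ y ∈ w.bypass.support, y ≠ b := fun y hy => hw y (w.support_bypass_subset_support hy)
  have hpath := w.bypass_isPath
  revert hw' hpath
  generalize w.bypass = w'
  intro hw' hpath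
  cases w' with
  | nil => exact hac rfl
  | @cons _ d _ had p =>
    rw [Walk.cons_isPath_iff] at hpath
    exact not_isPlanar_strongProd_of_cycle hxy hab hbc had (T := {y | y ∈ p.support}) hpath.2
      (fun hb => hw' b (List.mem_cons_of_mem _ hb) rfl) ⟨p, fun _ h => h⟩ hp

theorem nonempty_iso_pathGraph_three {a b c : V} (hab : H.Adj a b) (hbc : H.Adj b c)
    (hac : ¬ H.Adj a c) (hne : a ≠ c) (huniv : ∀ d, d = a ∨ d = b ∨ d = c) :
    Nonempty (H ≃g pathGraph 3) := by
  have hbij : Function.Bijective ![a, b, c] := by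
    refine ⟨fun i j h => ?_, fun d => ?_⟩
    · have := hab.ne; have := hbc.ne
      fin_cases i <;> fin_cases j <;> simp_all
    · rcases huniv d with rfl | rfl | rfl
      exacts [⟨0, rfl⟩, ⟨1, rfl⟩, ⟨2, rfl⟩]
  refine ⟨Iso.symm ⟨Equiv.ofBijective _ hbij, fun {i j} => ?_⟩⟩
  have hac' : ¬ H.Adj c a := fun h => hac h.symm
  fin_cases i <;> fin_cases j <;>
    simp [pathGraph_adj, hab, hbc, hac, hac', hab.symm, hbc.symm]

/-- If a product of two connected graphs is planar and the first has a path on three vertices,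
then the second, if it has at least three vertices, is a path on three vertices. -/
theorem nonempty_iso_pathGraph_three_of_strongProd [Finite V] [Finite W]
    (hp : (H.strongProd J).IsPlanar) (hH : H.Preconnected) (hJ : J.Preconnected)
    (hV : 3 ≤ Nat.card V) (hW : 3 ≤ Nat.card W) : Nonempty (J ≃g pathGraph 3) := by
  obtain ⟨x, y, z, hxz, hxy, hyz⟩ := hH.exists_path_three hV
  obtain ⟨a, b, c, hac, hab, hbc⟩ := hJ.exists_path_three hW
  have hac' : ¬ J.Adj a c := fun h => not_isPlanar_strongProd_of_cycle hxy hab hbc h (T := {c})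
    hac hbc.ne ⟨.nil, by simp⟩ hp
  refine nonempty_iso_pathGraph_three hab hbc hac' hac ?_
  by_contra! hd
  obtain ⟨d, hda, hdb, hdc⟩ := hd
  -- By connectivity a fourth vertex is attached to the path: at an end it makes a path on four
  -- vertices, at the middle a claw.
  obtain ⟨u, hu, v, hv, huv⟩ := hJ.exists_adj_notMem (S := {a, b, c}) (u := a) (v := d) (by simp)
    (by simp [hda, hdb, hdc])
  simp only [Set.mem_insert_iff, Set.mem_singleton_iff, not_or] at hu hv
  obtain ⟨hva, hvb, hvc⟩ := hv
  rcases hu with rfl | rfl | rfl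
  · exact not_isPlanar_strongProd_of_path hxy hyz hxz huv.symm hab hbc hvb hvc hac hp
  · refine not_isPlanar_strongProd_of_claw hxy hyz hxz (b := u) (l := ![a, c, v]) ?_ ?_ hp
    · intro i j h
      fin_cases i <;> fin_cases j <;> simp_all
    · intro j
      fin_cases j
      exacts [hab.symm, hbc, huv]
  · exact not_isPlanar_strongProd_of_path hxy hyz hxz hab hbc huv hac (Ne.symm hva) (Ne.symm hvb) hp

theorem nonempty_strongProd_iso_completeGraph_four (hV : Nat.card V = 2) (hW : Nat.card W = 2)
    (hH : H = ⊤) (hJ : J = ⊤) :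
    Nonempty (H.strongProd J ≃g completeGraph (Fin 4)) := by
  have : Finite V := Nat.finite_of_card_ne_zero (by omega)
  have : Finite W := Nat.finite_of_card_ne_zero (by omega)
  have htop : H.strongProd J = ⊤ := by
    ext p q
    simp only [strongProd_adj, hH, hJ, top_adj, ne_eq, Prod.ext_iff]
    tauto
  have e := Finite.equivFinOfCardEq (show Nat.card (V × W) = 4 by rw [Nat.card_prod, hV, hW])
  exact ⟨htop ▸ Iso.completeGraph e⟩

theorem Preconnected.eq_top_of_card_eq_two (hH : H.Preconnected) (hV : Nat.card V = 2) :
    H = ⊤ := by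
  ext u v
  refine ⟨Adj.ne, fun h => ?_⟩
  obtain ⟨z, huz⟩ := hH.exists_adj_of_ne h
  obtain ⟨p, q, -, hpq⟩ := Nat.card_eq_two_iff.1 hV
  have hm : ∀ t, t = p ∨ t = q := fun t => by
    have : t ∈ ({p, q} : Set V) := hpq ▸ Set.mem_univ t
    simpa using this
  have := huz.ne
  have hzv : z = v := by
    rw [top_adj] at h
    rcases hm u with rfl | rfl <;> rcases hm v with rfl | rfl <;> rcases hm z with rfl | rfl <;>
      simp_all
  exact hzv ▸ huz

/-- The possible `3`-polytopes among strong products. -/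
theorem IsThreePolytope.iso_or_iso [Finite V] [Finite W] [Nontrivial V] [Nontrivial W]
    (h : (H.strongProd J).IsThreePolytope) :
    Nonempty (H.strongProd J ≃g completeGraph (Fin 4)) ∨
      Nonempty (H.strongProd J ≃g (pathGraph 3).strongProd (pathGraph 3)) := by
  have hH := preconnected_left_of_strongProd h.2
  have hJ := preconnected_right_of_strongProd h.2
  have hV := Finite.one_lt_card (α := V)
  have hW := Finite.one_lt_card (α := W)
  have h' := h.of_iso (strongProdComm J H)
  rcases (show Nat.card V = 2 ∨ 3 ≤ Nat.card V by omega) with hV | hV <;>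
  rcases (show Nat.card W = 2 ∨ 3 ≤ Nat.card W by omega) with hW | hW
  · exact .inl (nonempty_strongProd_iso_completeGraph_four hV hW (hH.eq_top_of_card_eq_two hV)
      (hJ.eq_top_of_card_eq_two hW))
  · exact (not_isThreePolytope_strongProd_of_card_eq_two hV hW h).elim
  · exact (not_isThreePolytope_strongProd_of_card_eq_two hW hV h').elim
  · obtain ⟨e⟩ := nonempty_iso_pathGraph_three_of_strongProd h'.1 hJ hH hW hV
    obtain ⟨f⟩ := nonempty_iso_pathGraph_three_of_strongProd h.1 hH hJ hV hW
    exact .inr ⟨strongProdCongr e f⟩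

end StrongProduct

/-! ### Straight-line drawings -/

section Segments

variable {V : Type*}

/-- Twice the signed area of the triangle with the given corners. -/
def orientation {R : Type*} [CommRing R] (p q r : R × R) : R :=
  (q.1 - p.1) * (r.2 - p.2) - (q.2 - p.2) * (r.1 - p.1)

/-- The point of the Euclidean plane with the given integer coordinates. -/
noncomputable def planePoint (p : ℤ × ℤ) : EuclideanSpace ℝ (Fin 2) := !₂[(p.1 : ℝ), (p.2 : ℝ)]

theorem planePoint_injective : Function.Injective planePoint := by
  intro p q h
  have h₀ := congrArg (fun z => z 0) h
  have h₁ := congrArg (fun z => z 1) h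
  simp [planePoint] at h₀ h₁
  exact Prod.ext h₀ h₁

theorem orientation_eq_zero_of_mem_segment {p q : ℤ × ℤ} {z : EuclideanSpace ℝ (Fin 2)}
    (hz : z ∈ segment ℝ (planePoint p) (planePoint q)) :
    ((q.1 : ℝ) - p.1) * (z 1 - p.2) - (q.2 - p.2) * (z 0 - p.1) = 0 := by
  rw [segment_eq_image_lineMap] at hz
  obtain ⟨t, -, rfl⟩ := hz
  simp [planePoint, AffineMap.lineMap_apply]
  ring

/-- Orientation relative to `p q` is affine along the segment `r s` and vanishes at `z`. If its end
values do not have opposite signs, both terms of the convex combination vanish, and a nonzero end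
value forces `z` to be the other end. -/
theorem mem_pair_of_mem_segment_inter {p q r s : ℤ × ℤ} {z : EuclideanSpace ℝ (Fin 2)}
    (h : 0 ≤ orientation p q r * orientation p q s)
    (h0 : orientation p q r ≠ 0 ∨ orientation p q s ≠ 0)
    (hz : z ∈ segment ℝ (planePoint p) (planePoint q))
    (hz' : z ∈ segment ℝ (planePoint r) (planePoint s)) :
    z = planePoint r ∨ z = planePoint s := by
  have hzero := orientation_eq_zero_of_mem_segment hz
  rw [segment_eq_image_lineMap] at hz'
  obtain ⟨t, ⟨ht0, ht1⟩, rfl⟩ := hz'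
  set A := orientation p q r with hA
  set B := orientation p q s with hB
  have e : (1 - t) * (A : ℝ) + t * B = 0 := by
    rw [hA, hB]
    simp [planePoint, AffineMap.lineMap_apply] at hzero
    simp only [orientation]
    push_cast
    linear_combination hzero
  have hAB : (0 : ℝ) ≤ A * B := by exact_mod_cast h
  have hA2 : (1 - t) * (A : ℝ) = 0 := by
    have : (1 - t) * (A : ℝ) * ((1 - t) * A) ≤ 0 := by
      have h1 : (1 - t) * (A : ℝ) = - (t * B) := by linear_combination e
      have h2 := mul_nonneg (mul_nonneg ht0 (sub_nonneg.2 ht1)) hAB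
      calc (1 - t) * (A : ℝ) * ((1 - t) * A) = (1 - t) * A * -(t * B) := by rw [← h1]
        _ = - (t * (1 - t) * (A * B)) := by ring
        _ ≤ 0 := by linarith
    exact mul_self_eq_zero.1 (le_antisymm this (mul_self_nonneg _))
  have hB2 : t * (B : ℝ) = 0 := by linear_combination e - hA2
  rcases h0 with h0 | h0
  · right
    have : t = 1 := by
      have := (mul_eq_zero.1 hA2).resolve_right (by exact_mod_cast h0)
      linarith
    simp [this]
  · left
    have : t = 0 := (mul_eq_zero.1 hB2).resolve_right (by exact_mod_cast h0)
    simp [this]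

/-- A criterion for a straight-line drawing with integer coordinates in general position. -/
theorem isPlanar_of_orientation (G : SimpleGraph V) (c : V → ℤ × ℤ) (hc : Function.Injective c)
    (hgp : ∀ u v w, u ≠ v → u ≠ w → v ≠ w → orientation (c u) (c v) (c w) ≠ 0)
    (hcross : ∀ u v u' v', G.Adj u v → G.Adj u' v' →
      0 ≤ orientation (c u) (c v) (c u') * orientation (c u) (c v) (c v') ∨
        0 ≤ orientation (c u') (c v') (c u) * orientation (c u') (c v') (c v)) :
    G.IsPlanar := by
  have hinj := planePoint_injective.comp hc
  have hinter : ∀ {u v u' v' : V}, G.Adj u v → G.Adj u' v' → s(u, v) ≠ s(u', v') →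
      0 ≤ orientation (c u) (c v) (c u') * orientation (c u) (c v) (c v') →
      segment ℝ (planePoint (c u)) (planePoint (c v)) ∩
        segment ℝ (planePoint (c u')) (planePoint (c v')) ⊆ Set.range (planePoint ∘ c) := by
    intro u v u' v' h h' hne ho z ⟨hz, hz'⟩
    -- Distinct edges share at most one end, so some end of the second is off the first edge, and by
    -- general position off its line.
    have h0 : orientation (c u) (c v) (c u') ≠ 0 ∨ orientation (c u) (c v) (c v') ≠ 0 := by
      have hn := h'.ne
      by_cases h1 : u' ≠ u ∧ u' ≠ v
      · exact .inl (hgp _ _ _ h.ne h1.1.symm h1.2.symm)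
      by_cases h2 : v' ≠ u ∧ v' ≠ v
      · exact .inr (hgp _ _ _ h.ne h2.1.symm h2.2.symm)
      refine (hne ?_).elim
      rw [Sym2.eq_iff]
      grind
    rcases mem_pair_of_mem_segment_inter ho h0 hz hz' with rfl | rfl
    exacts [⟨u', rfl⟩, ⟨v', rfl⟩]
  exact ⟨{
    point := planePoint ∘ c
    point_injective := hinj
    arc := fun _ => Path.segment _ _
    arc_symm := fun _ => (Path.segment_symm _ _).symm
    arc_injective := fun h => Path.segment_injective_of_ne (hinj.ne h.ne)
    vertex_of_mem_arc := fun {u v} h w hw => by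
      rw [Path.range_segment] at hw
      have := orientation_eq_zero_of_mem_segment hw
      by_contra! hne
      refine hgp u v w h.ne hne.1.symm hne.2.symm ?_
      simp [planePoint] at this
      simp only [orientation]
      exact_mod_cast this
    arc_inter_arc := fun {u v u' v'} h h' hne => by
      rw [Path.range_segment, Path.range_segment]
      rcases hcross _ _ _ _ h h' with ho | ho
      · exact hinter h h' hne ho
      · rw [Set.inter_comm]
        exact hinter h' h hne.symm ho }⟩

end Segments
-- The polytopes `P₃ ⊠ P₃` and `K₄`
/-- Coordinates in general position for a straight-line drawing of `P₃ ⊠ P₃`. -/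
def kingCoordinates (p : Fin 3 × Fin 3) : ℤ × ℤ :=
  ![![(-3, -1), (-7, 0), (-2, 2)], ![(0, -6), (-1, 0), (0, 5)], ![(2, -1), (7, 1), (2, 1)]] p.1 p.2

/-- Equal or adjacent in `P₃ ⊠ P₃`: at most one king's move apart. -/
def KingStep (p q : Fin 3 × Fin 3) : Prop :=
  (p.1 = q.1 ∨ p.1.val + 1 = q.1.val ∨ q.1.val + 1 = p.1.val) ∧
    (p.2 = q.2 ∨ p.2.val + 1 = q.2.val ∨ q.2.val + 1 = p.2.val)

instance : DecidableRel KingStep := fun _ _ => inferInstanceAs (Decidable (_ ∧ _))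

theorem king_adj {p q : Fin 3 × Fin 3} : ((pathGraph 3).strongProd (pathGraph 3)).Adj p q ↔
    p ≠ q ∧ KingStep p q := by
  simp only [KingStep, strongProd_adj, pathGraph_adj, ne_eq, Prod.ext_iff, Fin.ext_iff]
  omega

theorem isPlanar_king : ((pathGraph 3).strongProd (pathGraph 3)).IsPlanar := by
  refine isPlanar_of_orientation _ kingCoordinates (by decide +kernel) ?_ ?_
  · unfold orientation
    decide +kernel
  · simp only [king_adj]
    unfold orientation
    decide +kernel

-- A hub within two steps of every surviving vertex turns connectivity into a finite check.
-- `KingStep` is reflexive, so shorter walks are included, and `s = t` covers the deletion of a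
-- single vertex.
set_option synthInstance.maxHeartbeats 200000 in
set_option synthInstance.maxSize 1000 in
theorem king_exists_hub : ∀ s t : Fin 3 × Fin 3, ∃ r, r ≠ s ∧ r ≠ t ∧ ∀ u, u ≠ s → u ≠ t →
    ∃ x, x ≠ s ∧ x ≠ t ∧ KingStep u x ∧ KingStep x r := by
  decide +kernel

theorem isVertexConnected_king :
    ((pathGraph 3).strongProd (pathGraph 3)).IsVertexConnected 3 := by
  refine isVertexConnected_iff_walkIn.2 ⟨by simp; norm_cast, fun S hS => ?_⟩
  have step : ∀ {u x : Fin 3 × Fin 3}, u ∉ S → x ∉ S →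
      KingStep u x →
      ((pathGraph 3).strongProd (pathGraph 3)).WalkIn {x | x ∉ S} u x := by
    intro u x hu hx h
    by_cases hux : u = x
    · exact hux ▸ .refl hu
    · exact .of_adj (king_adj.2 ⟨hux, h⟩) hu hx
  suffices ∃ r, ∀ u ∉ S, ((pathGraph 3).strongProd (pathGraph 3)).WalkIn {x | x ∉ S} u r by
    obtain ⟨r, hr⟩ := this
    exact fun u hu v hv => (hr u hu).trans (hr v hv).symm
  have pair : ∀ s t, S = {s, t} →
      ∃ r, ∀ u ∉ S, ((pathGraph 3).strongProd (pathGraph 3)).WalkIn {x | x ∉ S} u r := by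
    rintro s t rfl
    obtain ⟨r, hrs, hrt, hr⟩ := king_exists_hub s t
    refine ⟨r, fun u hu => ?_⟩
    have mem : ∀ {x : Fin 3 × Fin 3}, x ≠ s → x ≠ t → x ∉ ({s, t} : Finset (Fin 3 × Fin 3)) :=
      fun h h' => by simp [h, h']
    simp only [Finset.mem_insert, Finset.mem_singleton, not_or] at hu
    obtain ⟨x, hxs, hxt, h, h'⟩ := hr u hu.1 hu.2
    exact (step (mem hu.1 hu.2) (mem hxs hxt) h).trans (step (mem hxs hxt) (mem hrs hrt) h')
  rcases (show S.card = 0 ∨ S.card = 1 ∨ S.card = 2 by omega) with h | h | h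
  · refine ⟨(1, 1), fun u hu => step hu (by simp [Finset.card_eq_zero.1 h]) ?_⟩
    revert u
    simp only [Finset.card_eq_zero.1 h]
    decide
  · obtain ⟨s, rfl⟩ := Finset.card_eq_one.1 h
    exact pair s s (by simp)
  · obtain ⟨s, t, -, rfl⟩ := Finset.card_eq_two.1 h
    exact pair s t rfl

theorem isThreePolytope_king : ((pathGraph 3).strongProd (pathGraph 3)).IsThreePolytope :=
  ⟨isPlanar_king, isVertexConnected_king⟩

theorem isThreePolytope_completeGraph_four : (completeGraph (Fin 4)).IsThreePolytope := by
  -- A 2 × 2 block of `P₃ ⊠ P₃` is a clique, so `K₄` inherits its drawing.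
  refine ⟨isPlanar_king.of_hom (⟨![(0, 0), (0, 1), (1, 0), (1, 1)], ?_⟩ : _ →g _) ?_,
    isVertexConnected_iff_walkIn.2 ⟨by simp; norm_cast, fun S _ u hu v hv => ?_⟩⟩
  · simp only [king_adj, completeGraph, top_adj]
    decide
  · change Function.Injective ![((0 : Fin 3), (0 : Fin 3)), (0, 1), (1, 0), (1, 1)]
    decide
  · by_cases huv : u = v
    · exact huv ▸ .refl hu
    · exact .of_adj huv hu hv

end SimpleGraph

theorem mainTheorem8 {V W : Type*} [Finite V] [Finite W] [Nontrivial V] [Nontrivial W]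
    (H : SimpleGraph V) (J : SimpleGraph W) :
    ((H.strongProd J).IsThreePolytope ↔
      Nonempty (H.strongProd J ≃g SimpleGraph.completeGraph (Fin 4)) ∨
      Nonempty (H.strongProd J ≃g
        (SimpleGraph.pathGraph 3).strongProd (SimpleGraph.pathGraph 3))) ∧
    Nonempty ((SimpleGraph.completeGraph (Fin 2)).strongProd (SimpleGraph.completeGraph (Fin 2)) ≃g
      SimpleGraph.completeGraph (Fin 4)) := by
  refine ⟨⟨fun h => h.iso_or_iso, ?_⟩,
    SimpleGraph.nonempty_strongProd_iso_completeGraph_four (by simp) (by simp) rfl rfl⟩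
  rintro (⟨⟨e⟩⟩ | ⟨⟨e⟩⟩)
  · exact SimpleGraph.isThreePolytope_completeGraph_four.of_iso e
  · exact SimpleGraph.isThreePolytope_king.of_iso e
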